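/- For $n\ge 0$ let $\mathcal I_n$ be the set of involutions of $\{1,\dots,n\}$ (permutations $\pi$ with $\pi(\pi(i))=i$ for all $i$; the identity is included). For a set $T\subseteq\mathfrak S_k$ of patterns let $\mathcal I_n(T)$ be the set of those $\pi\in\mathcal I_n$ that contain no pattern of $T$, that is, for no $\tau\in T$ is there a subsequence $\pi_{i_1}\cdots\pi_{i_k}$ with $i_1<\dots<i_k$ that is order-isomorphic to $\tau$. Let $\mathcal A_k=\{\tau\in\mathfrak S_k:\tau_1=1,\ \tau_2=2\}$. Let $J_m(p)=\sum_{j=0}^m I_{m;j}\,p^j$, where $I_{m;j}$ is the number of involutions in $\mathcal I_m$ with exactly $j$ fixed points, and put $J_m(p)=0$ for $m<0$. (1) For every integer $k\ge 2$, as formal Laurent series in $x$ with coefficients in $\mathbb Q[p]$, $$\sum_{n\ge 0}\ \sum_{\pi\in\mathcal I_n(\mathcal A_k)} x^n p^{\#\text{fixed points}(\pi)}=\sum_{j=0}^{k-3}J_j(p)x^j-\frac{x^{k-3}}{2}\Bigl(p+\bigl(p(k-3)x^2-2x-p\bigr)u_0(x)\Bigr)J_{k-2}(p)-\frac{x^{k-4}}{2}\Bigl(x+p-\bigl(x^3(k-3)-px^2(k-1)+x+p\bigr)u_0(x)\Bigr)J_{k-3}(p),$$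 where $u_0(x)=1/\sqrt{1-2(k-1)x^2+(k-3)^2x^4}$ is the formal power series with constant term $1$, and the first sum is empty for $k=2$. (2) For every $n\ge 0$, the number of involutions of length $n$ that avoid $123$ is $\binom{n}{\lfloor n/2\rfloor}$. (3) The generating function for the number of involutions of length $n$ that avoid both $1234$ and $1243$ is $$\sum_{n\ge 0}|\mathcal I_n(1234,1243)|\,x^n=\frac{1-x}{2}+\frac{1+x}{2}\sqrt{\frac{1+2x-x^2}{1-2x-x^2}},$$ where the square root is the power series with constant term $1$. -/

import Mathlib

namespace InvAvoid

/-- The permutation `π` of `Fin n` contains the pattern `τ` of `Fin k`: some positions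
`f 0 < ⋯ < f (k-1)` carry values of `π` in the same relative order as the values of `τ`.
Positions and values are numbered from `0` instead of from `1`. -/
def Contains {n k : ℕ} (π : Equiv.Perm (Fin n)) (τ : Equiv.Perm (Fin k)) : Prop :=
  ∃ f : Fin k → Fin n, StrictMono f ∧ ∀ a b : Fin k, π (f a) < π (f b) ↔ τ a < τ b

/-- The permutation `π` avoids every pattern in `T`. -/
def Avoids {n k : ℕ} (π : Equiv.Perm (Fin n)) (T : Set (Equiv.Perm (Fin k))) : Prop :=
  ∀ τ ∈ T, ¬ Contains π τ

/-- The permutations of length `k` with prefix `12`, that is (from `0`) those that fix `0` and `1`. -/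
def prefixOneTwo (k : ℕ) : Set (Equiv.Perm (Fin k)) :=
  {τ | ∀ i : Fin k, (i : ℕ) < 2 → τ i = i}

open Classical in
/-- The involutions of length `n` (the identity included). -/
noncomputable def involutions (n : ℕ) : Finset (Equiv.Perm (Fin n)) :=
  Finset.univ.filter fun π => ∀ i, π (π i) = i

open Classical in
/-- The involutions of length `n` that avoid all patterns in `T`. -/
noncomputable def avoidingInvolutions (n : ℕ) {k : ℕ} (T : Set (Equiv.Perm (Fin k))) :
    Finset (Equiv.Perm (Fin n)) :=
  (involutions n).filter fun π => Avoids π T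

/-- The number of fixed points of `π`. -/
def numFixed {n : ℕ} (π : Equiv.Perm (Fin n)) : ℕ :=
  (Finset.univ.filter fun i => π i = i).card

/-- The number of involutions of length `n` with exactly `j` fixed points. -/
noncomputable def numInvolutions (n j : ℕ) : ℕ :=
  ((involutions n).filter fun π => numFixed π = j).card

/-- The involution polynomial `J_m(p) = ∑ j ≤ m, I_{m;j} p ^ j`, where `p` is `Polynomial.X`.
There are no involutions of negative length, so `J_m = 0` for `m < 0`. -/
noncomputable def involutionPoly (m : ℤ) : Polynomial ℚ :=
  if 0 ≤ m then
    ∑ j ∈ Finset.range (m.toNat + 1), (numInvolutions m.toNat j : Polynomial ℚ) * Polynomial.X ^ j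
  else 0

/-- The bivariate generating function `∑ n, ∑ π, x ^ n * p ^ (number of fixed points of π)`, where
`π` runs over the involutions of length `n` that avoid the permutations with prefix `12`. -/
noncomputable def genFun (k : ℕ) : PowerSeries (Polynomial ℚ) :=
  PowerSeries.mk fun n =>
    ∑ π ∈ avoidingInvolutions n (prefixOneTwo k), (Polynomial.X : Polynomial ℚ) ^ numFixed π

/-- The power `f ^ r`, for a rational exponent `r` and a formal power series `f` with constant
coefficient `1`, as the binomial series `∑ m, (r choose m) (f - 1) ^ m`. -/
noncomputable def binomPow {A : Type*} [CommRing A] [Algebra ℚ A] (f : PowerSeries A) (r : ℚ) :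
    PowerSeries A :=
  PowerSeries.subst (f - 1) (PowerSeries.binomialSeries A r)

theorem hasSubst_sub_one {A : Type*} [CommRing A] {f : PowerSeries A}
    (hf : PowerSeries.constantCoeff f = 1) : PowerSeries.HasSubst (f - 1) :=
  PowerSeries.HasSubst.of_constantCoeff_zero' (by simp [hf])

theorem binomPow_add {A : Type*} [CommRing A] [Algebra ℚ A] {f : PowerSeries A}
    (hf : PowerSeries.constantCoeff f = 1) (r s : ℚ) :
    binomPow f (r + s) = binomPow f r * binomPow f s := by
  unfold binomPow
  rw [PowerSeries.binomialSeries_add, PowerSeries.subst_mul (hasSubst_sub_one hf)]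

theorem binomPow_natCast {A : Type*} [CommRing A] [Algebra ℚ A] {f : PowerSeries A}
    (hf : PowerSeries.constantCoeff f = 1) (d : ℕ) : binomPow f (d : ℚ) = f ^ d := by
  have h := hasSubst_sub_one hf
  unfold binomPow
  rw [PowerSeries.binomialSeries_nat, ← PowerSeries.coe_substAlgHom h, map_pow, map_add, map_one,
    PowerSeries.coe_substAlgHom h, PowerSeries.subst_X h]
  congr 1
  ring

theorem constantCoeff_binomPow {A : Type*} [CommRing A] [Algebra ℚ A] {f : PowerSeries A}
    (hf : PowerSeries.constantCoeff f = 1) (r : ℚ) :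
    PowerSeries.constantCoeff (binomPow f r) = 1 := by
  have h0 : PowerSeries.constantCoeff (PowerSeries.binomialSeries A r - 1) = 0 := by simp
  have h := PowerSeries.constantCoeff_subst_eq_zero (a := f - 1) (by
    change PowerSeries.constantCoeff (f - 1) = 0
    simp [hf]) _ h0
  rw [PowerSeries.subst_sub (hasSubst_sub_one hf)] at h
  have h1 : PowerSeries.subst (f - 1) (1 : PowerSeries A) = (1 : PowerSeries A) := by
    rw [← PowerSeries.coe_substAlgHom (hasSubst_sub_one hf), map_one]
  rw [h1] at h
  change PowerSeries.constantCoeff (binomPow f r - 1) = 0 at h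
  rw [map_sub, map_one] at h
  exact sub_eq_zero.mp h

/-- `binomPow f (1 / 2)` is a square root of `f`. -/
theorem binomPow_half_sq {A : Type*} [CommRing A] [Algebra ℚ A] {f : PowerSeries A}
    (hf : PowerSeries.constantCoeff f = 1) : binomPow f (1 / 2) ^ 2 = f := by
  rw [sq, ← binomPow_add hf]
  have h := binomPow_natCast hf 1
  norm_num at h ⊢
  exact h

/-- `binomPow f (-1 / 2)` is an inverse of a square root of `f`. -/
theorem binomPow_neg_half_sq {A : Type*} [CommRing A] [Algebra ℚ A] {f : PowerSeries A}
    (hf : PowerSeries.constantCoeff f = 1) : binomPow f (-1 / 2) ^ 2 * f = 1 := by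
  have h := binomPow_natCast hf 0
  rw [Nat.cast_zero, pow_zero, show (0 : ℚ) = -1 / 2 + 1 / 2 by norm_num, binomPow_add hf] at h
  calc binomPow f (-1 / 2) ^ 2 * f
      = binomPow f (-1 / 2) ^ 2 * binomPow f (1 / 2) ^ 2 := by rw [binomPow_half_sq hf]
    _ = (binomPow f (-1 / 2) * binomPow f (1 / 2)) ^ 2 := by ring
    _ = 1 := by rw [h, one_pow]

/-- The series `u₀(x) = 1 / √(1 - 2 (k - 1) x ^ 2 + (k - 3) ^ 2 x ^ 4)`. -/
noncomputable def uZero (k : ℕ) : PowerSeries (Polynomial ℚ) :=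
  binomPow (1 - 2 * ((k : PowerSeries (Polynomial ℚ)) - 1) * PowerSeries.X ^ 2
    + ((k : PowerSeries (Polynomial ℚ)) - 3) ^ 2 * PowerSeries.X ^ 4) (-1 / 2)

/-- A power series in `x` over `ℚ[p]`, as a Laurent series. -/
noncomputable abbrev toLaurent (f : PowerSeries (Polynomial ℚ)) : LaurentSeries (Polynomial ℚ) :=
  HahnSeries.ofPowerSeries ℤ (Polynomial ℚ) f

/-- A polynomial in `p`, as a constant Laurent series in `x`. -/
noncomputable abbrev con (c : Polynomial ℚ) : LaurentSeries (Polynomial ℚ) :=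
  HahnSeries.C c

/-- The variable `p`, as a constant Laurent series in `x`. -/
noncomputable abbrev p : LaurentSeries (Polynomial ℚ) := con Polynomial.X

/-- The monomial `x ^ m`, for an integer `m`. -/
noncomputable abbrev xPow (m : ℤ) : LaurentSeries (Polynomial ℚ) := HahnSeries.single m 1

/-- The variable `x`. -/
noncomputable abbrev x : LaurentSeries (Polynomial ℚ) := xPow 1

end InvAvoid

namespace InvAvoid

/-! Write d = k - 2 and call a point deep if at least d points lie to its north-east. Any d points
north-east of the larger element of an ascent complete it to some pattern with prefix 12, whatever
their order. Hence avoidance means that every deep point is a left-to-right minimum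
(`avoids_prefixOneTwo_iff`).

Every involution is built uniquely by inserting in front either a fixed point or a two-cycle through
the first position (`sum_involutions_add_two`). Whether the result is good, and its depth, depend
only on the length n, the depth and the inserted position, so good involutions form a generating
tree.

For n ≥ d set e = n - depth - d. At nonzero depth only two-cycles are allowed; they give children
with parameters 0, ..., e once each and e + 1 exactly d times. The subtree series f(e) then
satisfies f(e) = 1 + x²(f(0) + ... + f(e) + d f(e+1)), which β T^e solves when T is a root of a
quadratic kernel. At depth 0 a fixed point may also be added, and γ T^e is the solution. Convergence
over the infinite tree is replaced by a telescoping identity modulo x^m (`sum_X_pow_coeff_genFun`).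

All involutions of length at most d are good, so the tree is entered at length d, and at length d +
1 by two-cycles inserted into involutions of length d - 1. This gives `genFun_eq`; solving the
quadratic (`exists_isKernelSolution`) yields the closed form. The other two claims are p = 1 with k
= 3 and k = 4. -/

open Finset

/-! ### North-east counts and depth -/

/-- The points of the graph of `π` lying strictly above and to the right of the point at `i`. -/
def northEast {n : ℕ} (π : Equiv.Perm (Fin n)) (i : Fin n) : Finset (Fin n) :=
  univ.filter fun j => i < j ∧ π i < π j

theorem mem_northEast {n : ℕ} {π : Equiv.Perm (Fin n)} {i j : Fin n} :
    j ∈ northEast π i ↔ i < j ∧ π i < π j := by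
  simp [northEast]

/-- Every point of `π` with at least `d` points to its north-east is a left-to-right minimum. -/
def IsGood (d : ℕ) {n : ℕ} (π : Equiv.Perm (Fin n)) : Prop :=
  ∀ i j, i < j → π i < π j → (northEast π j).card < d

/-- One plus the last position with at least `d` points to its north-east, or `0` if there is
none. -/
def depth (d : ℕ) {n : ℕ} (π : Equiv.Perm (Fin n)) : ℕ :=
  (univ.filter fun i => d ≤ (northEast π i).card).sup fun i => (i : ℕ) + 1

theorem depth_le_iff {d n b : ℕ} {π : Equiv.Perm (Fin n)} :
    depth d π ≤ b ↔ ∀ i, d ≤ (northEast π i).card → (i : ℕ) < b := by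
  simp [depth, Finset.sup_le_iff]

theorem depth_eq_zero_iff {d n : ℕ} {π : Equiv.Perm (Fin n)} :
    depth d π = 0 ↔ ∀ i, (northEast π i).card < d := by
  rw [← Nat.le_zero, depth_le_iff]
  simp

theorem card_northEast_add_le {n : ℕ} (π : Equiv.Perm (Fin n)) (i : Fin n) :
    (northEast π i).card + (i + 1) ≤ n := by
  have h : northEast π i ⊆ Ioi i := fun j hj => by
    exact mem_Ioi.2 (mem_northEast.1 hj).1
  have := card_le_card h
  rw [Fin.card_Ioi] at this
  omega

/-- The last d positions have fewer than d positions to their right, so none is deep. This makes the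
truncated difference `n - depth d π - d` a true difference. -/
theorem depth_add_le {d n : ℕ} (hd : d ≤ n) (π : Equiv.Perm (Fin n)) : depth d π + d ≤ n := by
  have : depth d π ≤ n - d := depth_le_iff.2 fun i hi => by
    have := card_northEast_add_le π i
    omega
  omega

/-- The graph of an involution is symmetric in the diagonal, and the reflection preserves the
north-east relation. -/
theorem card_northEast_apply {n : ℕ} {π : Equiv.Perm (Fin n)} (hπ : ∀ i, π (π i) = i)
    (i : Fin n) : (northEast π (π i)).card = (northEast π i).card := by
  refine card_bij' (fun j _ => π j) (fun j _ => π j) ?_ ?_ ?_ ?_ <;>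
    simp +contextual [mem_northEast, hπ]

/-! ### Building involutions from the front -/

/-- Put a fixed point before `σ`. -/
def addFix {n : ℕ} (σ : Equiv.Perm (Fin n)) : Equiv.Perm (Fin (n + 1)) :=
  Equiv.Perm.decomposeFin.symm (0, σ)

@[simp] theorem addFix_zero {n : ℕ} (σ : Equiv.Perm (Fin n)) : addFix σ 0 = 0 := by
  simp [addFix]

@[simp] theorem addFix_succ {n : ℕ} (σ : Equiv.Perm (Fin n)) (i : Fin n) :
    addFix σ i.succ = (σ i).succ := by
  simp [addFix]

/-- The order embedding with range the complement of `0` and `w + 1`. -/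
def skip {n : ℕ} (w : Fin (n + 1)) (i : Fin n) : Fin (n + 2) := (w.succAbove i).succ

@[simp] theorem skip_lt_skip {n : ℕ} (w : Fin (n + 1)) (i j : Fin n) :
    skip w i < skip w j ↔ i < j := by
  simp [skip]

@[simp] theorem skip_inj {n : ℕ} (w : Fin (n + 1)) (i j : Fin n) :
    skip w i = skip w j ↔ i = j := by
  simp [skip]

@[simp] theorem skip_ne_zero {n : ℕ} (w : Fin (n + 1)) (i : Fin n) : skip w i ≠ 0 :=
  Fin.succ_ne_zero _

@[simp] theorem skip_ne_succ {n : ℕ} (w : Fin (n + 1)) (i : Fin n) : skip w i ≠ w.succ := by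
  simp [skip]

theorem skip_pos {n : ℕ} (w : Fin (n + 1)) (i : Fin n) : 0 < skip w i := Fin.succ_pos _

theorem succ_lt_skip_iff {n : ℕ} (w : Fin (n + 1)) (i : Fin n) :
    w.succ < skip w i ↔ (w : ℕ) ≤ i := by
  simp [skip, Fin.lt_succAbove_iff_le_castSucc, Fin.le_def]

theorem val_skip_of_lt {n : ℕ} {w : Fin (n + 1)} {i : Fin n} (h : (i : ℕ) < w) :
    (skip w i : ℕ) = i + 1 := by
  rw [skip, Fin.succAbove_of_castSucc_lt _ _ (by simpa [Fin.lt_def] using h)]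
  simp

theorem exists_skip {n : ℕ} (w : Fin (n + 1)) (i : Fin (n + 2)) :
    i = 0 ∨ i = w.succ ∨ ∃ j, i = skip w j := by
  induction i using Fin.cases with
  | zero => exact Or.inl rfl
  | succ i =>
    rcases Fin.eq_self_or_eq_succAbove w i with rfl | ⟨j, rfl⟩
    · exact Or.inr (Or.inl rfl)
    · exact Or.inr (Or.inr ⟨j, rfl⟩)

/-- The function underlying `addPair`. -/
def addPairFun {n : ℕ} (w : Fin (n + 1)) (f : Fin n → Fin n) : Fin (n + 2) → Fin (n + 2) :=
  Fin.cons w.succ (Fin.insertNth (α := fun _ => Fin (n + 2)) w 0 fun i => skip w (f i))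

theorem addPairFun_zero {n : ℕ} (w : Fin (n + 1)) (f : Fin n → Fin n) :
    addPairFun w f 0 = w.succ := rfl

theorem addPairFun_succ {n : ℕ} (w : Fin (n + 1)) (f : Fin n → Fin n) :
    addPairFun w f w.succ = 0 := by
  simp [addPairFun]

theorem addPairFun_skip {n : ℕ} (w : Fin (n + 1)) (f : Fin n → Fin n) (i : Fin n) :
    addPairFun w f (skip w i) = skip w (f i) := by
  simp [addPairFun, skip]

theorem addPairFun_addPairFun {n : ℕ} (w : Fin (n + 1)) {f g : Fin n → Fin n}
    (h : ∀ i, f (g i) = i) (i : Fin (n + 2)) : addPairFun w f (addPairFun w g i) = i := by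
  rcases exists_skip w i with rfl | rfl | ⟨j, rfl⟩ <;>
    simp [addPairFun_zero, addPairFun_succ, addPairFun_skip, h]

/-- Insert into `σ` a two-cycle exchanging `0` and `w + 1`. -/
def addPair {n : ℕ} (w : Fin (n + 1)) (σ : Equiv.Perm (Fin n)) : Equiv.Perm (Fin (n + 2)) where
  toFun := addPairFun w σ
  invFun := addPairFun w σ.symm
  left_inv := addPairFun_addPairFun w σ.symm_apply_apply
  right_inv := addPairFun_addPairFun w σ.apply_symm_apply

@[simp] theorem addPair_zero {n : ℕ} (w : Fin (n + 1)) (σ : Equiv.Perm (Fin n)) :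
    addPair w σ 0 = w.succ := rfl

@[simp] theorem addPair_succ {n : ℕ} (w : Fin (n + 1)) (σ : Equiv.Perm (Fin n)) :
    addPair w σ w.succ = 0 := addPairFun_succ w σ

@[simp] theorem addPair_skip {n : ℕ} (w : Fin (n + 1)) (σ : Equiv.Perm (Fin n)) (i : Fin n) :
    addPair w σ (skip w i) = skip w (σ i) := addPairFun_skip w σ i

theorem mem_involutions {n : ℕ} {π : Equiv.Perm (Fin n)} :
    π ∈ involutions n ↔ ∀ i, π (π i) = i := by
  simp [involutions]

theorem addFix_mem_involutions {n : ℕ} {σ : Equiv.Perm (Fin n)} :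
    addFix σ ∈ involutions (n + 1) ↔ σ ∈ involutions n := by
  simp [mem_involutions, Fin.forall_fin_succ (n := n)]

theorem addPair_mem_involutions {n : ℕ} {w : Fin (n + 1)} {σ : Equiv.Perm (Fin n)} :
    addPair w σ ∈ involutions (n + 2) ↔ σ ∈ involutions n := by
  simp only [mem_involutions]
  constructor
  · intro h i
    simpa using h (skip w i)
  · intro h i
    rcases exists_skip w i with rfl | rfl | ⟨j, rfl⟩ <;> simp [h]

theorem numFixed_addFix {n : ℕ} (σ : Equiv.Perm (Fin n)) :
    numFixed (addFix σ) = numFixed σ + 1 := by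
  simp only [numFixed, card_filter, Fin.sum_univ_succ (n := n), addFix_zero, addFix_succ,
    Fin.succ_inj, if_true, add_comm]

theorem numFixed_addPair {n : ℕ} (w : Fin (n + 1)) (σ : Equiv.Perm (Fin n)) :
    numFixed (addPair w σ) = numFixed σ := by
  have h (i : Fin n) : addPair w σ (w.succAbove i).succ = (w.succAbove i).succ ↔ σ i = i := by
    change addPair w σ (skip w i) = skip w i ↔ _
    simp
  simp only [numFixed, card_filter, Fin.sum_univ_succ (n := n + 1), Fin.sum_univ_succAbove _ w, h,
    addPair_zero, addPair_succ, Fin.succ_ne_zero, (Fin.succ_ne_zero _).symm, if_false, zero_add]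

theorem exists_eq_addFix {n : ℕ} {π : Equiv.Perm (Fin (n + 1))} (h : π 0 = 0) :
    ∃ σ, π = addFix σ := by
  obtain ⟨⟨a, σ⟩, rfl⟩ := Equiv.Perm.decomposeFin.symm.surjective π
  simp only [Equiv.Perm.decomposeFin_symm_apply_zero] at h
  exact ⟨σ, by rw [h, addFix]⟩

theorem exists_eq_addPair {n : ℕ} {π : Equiv.Perm (Fin (n + 2))} (hπ : ∀ i, π (π i) = i)
    {w : Fin (n + 1)} (h : π 0 = w.succ) : ∃ σ, π = addPair w σ := by
  have hw : π w.succ = 0 := by rw [← h, hπ]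
  have key (i : Fin n) : ∃ j, π (skip w i) = skip w j := by
    rcases exists_skip w (π (skip w i)) with h0 | h0 | h0
    · exact absurd (π.injective (h0.trans hw.symm)) (by simp)
    · exact absurd (π.injective (h0.trans h.symm)) (by simp)
    · exact h0
  choose f hf using key
  have hff : Function.Involutive f := fun i => by
    have := hπ (skip w i)
    rw [hf, hf] at this
    simpa using this
  refine ⟨hff.toPerm, Equiv.ext fun i => ?_⟩
  rcases exists_skip w i with rfl | rfl | ⟨j, rfl⟩ <;> simp [h, hw, hf]

theorem addFix_injective {n : ℕ} : Function.Injective (addFix (n := n)) := fun σ τ h => by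
  ext i
  have := congrArg (fun π => π i.succ) h
  simpa [Fin.ext_iff] using this

theorem addPair_inj {n : ℕ} {w v : Fin (n + 1)} {σ τ : Equiv.Perm (Fin n)}
    (h : addPair w σ = addPair v τ) : w = v ∧ σ = τ := by
  have hw : w = v := by
    have := congrArg (fun π => π 0) h
    simpa using this
  subst hw
  refine ⟨rfl, Equiv.ext fun i => ?_⟩
  have := congrArg (fun π => π (skip w i)) h
  simpa using this

theorem sum_involutions_zero {M : Type*} [AddCommMonoid M] (F : Equiv.Perm (Fin 0) → M) :
    ∑ π ∈ involutions 0, F π = F 1 := by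
  have : involutions 0 = {1} := by
    ext π
    simp [mem_involutions, Subsingleton.elim π 1]
  simp [this]

theorem sum_involutions_fixed {M : Type*} [AddCommMonoid M] {n : ℕ}
    (F : Equiv.Perm (Fin (n + 1)) → M) :
    ∑ π ∈ involutions (n + 1) with π 0 = 0, F π = ∑ σ ∈ involutions n, F (addFix σ) := by
  symm
  refine sum_bij (fun σ _ => addFix σ) ?_ ?_ ?_ ?_
  · intro σ hσ
    simpa [addFix_mem_involutions] using hσ
  · intro σ _ τ _ h
    exact addFix_injective h
  · intro π hπ
    rw [mem_filter] at hπ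
    obtain ⟨σ, rfl⟩ := exists_eq_addFix hπ.2
    exact ⟨σ, addFix_mem_involutions.1 hπ.1, rfl⟩
  · intros
    rfl

theorem sum_involutions_one {M : Type*} [AddCommMonoid M] (F : Equiv.Perm (Fin 1) → M) :
    ∑ π ∈ involutions 1, F π = ∑ σ ∈ involutions 0, F (addFix σ) := by
  rw [← sum_involutions_fixed, filter_true_of_mem]
  intros
  exact Subsingleton.elim (α := Fin 1) _ _

/-- An involution of length `n + 2` arises from adding a fixed point or a two-cycle. -/
theorem sum_involutions_add_two {M : Type*} [AddCommMonoid M] {n : ℕ}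
    (F : Equiv.Perm (Fin (n + 2)) → M) :
    ∑ π ∈ involutions (n + 2), F π = ∑ σ ∈ involutions (n + 1), F (addFix σ) +
      ∑ σ ∈ involutions n, ∑ w, F (addPair w σ) := by
  rw [← sum_filter_add_sum_filter_not _ (fun π => π 0 = 0), sum_involutions_fixed, ← sum_product']
  congr 1
  symm
  refine sum_bij (fun a _ => addPair a.2 a.1) ?_ ?_ ?_ ?_
  · rintro ⟨σ, w⟩ h
    simpa [addPair_mem_involutions] using h
  · rintro ⟨σ, w⟩ _ ⟨τ, v⟩ _ h
    obtain ⟨h1, h2⟩ := addPair_inj h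
    exact Prod.ext h2 h1
  · intro π hπ
    rw [mem_filter] at hπ
    obtain ⟨w, hw⟩ := Fin.exists_succ_eq.2 hπ.2
    obtain ⟨σ, rfl⟩ := exists_eq_addPair (mem_involutions.1 hπ.1) hw.symm
    exact ⟨(σ, w), by simpa [addPair_mem_involutions] using hπ.1, rfl⟩
  · intros
    rfl

/-! ### Effect of an insertion on goodness and depth -/

theorem card_northEast_addFix_zero {n : ℕ} (σ : Equiv.Perm (Fin n)) :
    (northEast (addFix σ) 0).card = n := by
  have : northEast (addFix σ) 0 = univ.map (Fin.succEmb n) := by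
    ext j
    induction j using Fin.cases <;> simp [mem_northEast]
  simp [this]

theorem card_northEast_addFix_succ {n : ℕ} (σ : Equiv.Perm (Fin n)) (i : Fin n) :
    (northEast (addFix σ) i.succ).card = (northEast σ i).card := by
  have : northEast (addFix σ) i.succ = (northEast σ i).map (Fin.succEmb n) := by
    ext j
    induction j using Fin.cases <;> simp [mem_northEast]
  simp [this]

theorem card_northEast_addPair_zero {n : ℕ} (w : Fin (n + 1)) (σ : Equiv.Perm (Fin n)) :
    (northEast (addPair w σ) 0).card = n - w := by
  have : (northEast (addPair w σ) 0).map (addPair w σ).toEmbedding = Ioi w.succ := by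
    ext j
    obtain ⟨i, rfl⟩ := (addPair w σ).surjective j
    rw [← Equiv.coe_toEmbedding, mem_map', Equiv.coe_toEmbedding, mem_northEast]
    rcases exists_skip w i with rfl | rfl | ⟨j, rfl⟩ <;> simp [skip_pos]
  rw [← card_map, this, Fin.card_Ioi, Fin.val_succ]
  omega

theorem card_northEast_addPair_succ {n : ℕ} (w : Fin (n + 1)) (σ : Equiv.Perm (Fin n)) :
    (northEast (addPair w σ) w.succ).card = n - w := by
  have : northEast (addPair w σ) w.succ = Ioi w.succ := by
    ext i
    rcases exists_skip w i with rfl | rfl | ⟨j, rfl⟩ <;> simp [mem_northEast, skip_pos]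
  rw [this, Fin.card_Ioi, Fin.val_succ]
  omega

theorem card_northEast_addPair_skip {n : ℕ} (w : Fin (n + 1)) (σ : Equiv.Perm (Fin n))
    (i : Fin n) : (northEast (addPair w σ) (skip w i)).card = (northEast σ i).card := by
  have : northEast (addPair w σ) (skip w i) = (northEast σ i).image (skip w) := by
    ext j
    rcases exists_skip w j with rfl | rfl | ⟨j, rfl⟩ <;> simp [mem_northEast]
  rw [this, card_image_of_injective _ fun a b h => (skip_inj w a b).1 h]

/-- The new point is south-west of all others, so none of the old points stays a left-to-right
minimum and none may be deep. -/
theorem isGood_addFix {d n : ℕ} {σ : Equiv.Perm (Fin n)} :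
    IsGood d (addFix σ) ↔ depth d σ = 0 := by
  rw [depth_eq_zero_iff]
  constructor
  · intro h i
    have := h 0 i.succ (by simp) (by simp)
    rwa [card_northEast_addFix_succ] at this
  · intro h i j hij _
    obtain ⟨j, rfl⟩ := Fin.exists_succ_eq.2 (Fin.ne_zero_of_lt hij)
    rw [card_northEast_addFix_succ]
    exact h j

theorem depth_addFix {d n : ℕ} {σ : Equiv.Perm (Fin n)} (hd : d ≤ n) (h : depth d σ = 0) :
    depth d (addFix σ) = 1 := by
  rw [depth_eq_zero_iff] at h
  refine eq_of_forall_ge_iff fun b => ?_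
  rw [depth_le_iff, Fin.forall_fin_succ]
  simp [card_northEast_addFix_zero, card_northEast_addFix_succ, hd, (h _).not_ge, Nat.succ_le_iff]

/-- Both new points are left-to-right minima, and old north-east counts do not change. The new point
of value 0 lies south-west of exactly the old points at positions at least w, the new point at
position 0 of those with values at least w; neither kind may contain a deep point. -/
theorem isGood_addPair {d n : ℕ} {w : Fin (n + 1)} {σ : Equiv.Perm (Fin n)}
    (hσ : ∀ i, σ (σ i) = i) : IsGood d (addPair w σ) ↔ IsGood d σ ∧ depth d σ ≤ w := by
  rw [depth_le_iff]
  constructor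
  · refine fun h => ⟨fun i j hij hσij => ?_, fun i hi => ?_⟩
    · have := h (skip w i) (skip w j) (by simpa) (by simpa)
      rwa [card_northEast_addPair_skip] at this
    · by_contra! hw
      have := h w.succ (skip w i) (by rwa [succ_lt_skip_iff]) (by simp [skip_pos])
      rw [card_northEast_addPair_skip] at this
      omega
  · rintro ⟨hg, hw⟩ i j hij hσij
    rcases exists_skip w j with rfl | rfl | ⟨j, rfl⟩
    · simp at hij
    · simp at hσij
    rw [card_northEast_addPair_skip]
    by_contra! hj
    rcases exists_skip w i with rfl | rfl | ⟨i, rfl⟩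
    · rw [addPair_zero, addPair_skip, succ_lt_skip_iff] at hσij
      -- By symmetry the partner of a deep point is deep, so the bound on positions also bounds
      -- values.
      have := hw (σ j) (by rwa [card_northEast_apply hσ])
      omega
    · rw [succ_lt_skip_iff] at hij
      have := hw j hj
      omega
    · have := hg i j (by simpa using hij) (by simpa using hσij)
      omega

/-- Old deep positions are below w and shift by one; both new points have n - w points to their
north-east, and the later one is at position w + 1. -/
theorem depth_addPair_le_iff {d n b : ℕ} {w : Fin (n + 1)} {σ : Equiv.Perm (Fin n)}
    (h : depth d σ ≤ w) : depth d (addPair w σ) ≤ b ↔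
      (d ≤ n - w → (w : ℕ) + 2 ≤ b) ∧ ∀ i, d ≤ (northEast σ i).card → (i : ℕ) + 1 < b := by
  rw [depth_le_iff] at h ⊢
  constructor
  · refine fun h' => ⟨fun hd => ?_, fun i hi => ?_⟩
    · have := h' w.succ (by rwa [card_northEast_addPair_succ])
      rw [Fin.val_succ] at this
      omega
    · have := h' (skip w i) (by rwa [card_northEast_addPair_skip])
      rwa [val_skip_of_lt (h i hi)] at this
  · rintro ⟨h1, h2⟩ i hi
    rcases exists_skip w i with rfl | rfl | ⟨i, rfl⟩
    · rw [card_northEast_addPair_zero] at hi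
      have := h1 hi
      rw [Fin.val_zero]
      omega
    · rw [card_northEast_addPair_succ] at hi
      have := h1 hi
      rw [Fin.val_succ]
      omega
    · rw [card_northEast_addPair_skip] at hi
      rw [val_skip_of_lt (h i hi)]
      exact h2 i hi

theorem depth_addPair_of_le {d n : ℕ} {w : Fin (n + 1)} {σ : Equiv.Perm (Fin n)}
    (h : depth d σ ≤ w) (hd : d ≤ n - w) : depth d (addPair w σ) = w + 2 := by
  refine eq_of_forall_ge_iff fun b => ?_
  rw [depth_addPair_le_iff h]
  rw [depth_le_iff] at h
  refine ⟨fun h' => h'.1 hd, fun h' => ⟨fun _ => h', fun i hi => ?_⟩⟩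
  have := h i hi
  omega

theorem depth_addPair_of_lt {d n : ℕ} {w : Fin (n + 1)} {σ : Equiv.Perm (Fin n)}
    (h : depth d σ ≤ w) (hd : n - w < d) :
    depth d (addPair w σ) = if depth d σ = 0 then 0 else depth d σ + 1 := by
  refine eq_of_forall_ge_iff fun b => ?_
  rw [depth_addPair_le_iff h]
  split_ifs with h0
  · rw [depth_eq_zero_iff] at h0
    simp [hd.not_ge, (h0 _).not_ge]
  · cases b with
    | zero =>
      rw [depth_eq_zero_iff] at h0
      push Not at h0
      simpa [hd.not_ge] using h0
    | succ b => simp [hd.not_ge, depth_le_iff]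

/-! ### Pattern avoidance as a north-east condition -/

/-- Every injective word is order-isomorphic to a permutation. -/
theorem exists_perm_lt_iff {k : ℕ} {α : Type*} [LinearOrder α] {u : Fin k → α}
    (hu : Function.Injective u) :
    ∃ τ : Equiv.Perm (Fin k), ∀ a b, u a < u b ↔ τ a < τ b := by
  have hc : (univ.image u).card = k := by rw [card_image_of_injective _ hu, card_fin]
  let e := (univ.image u).orderIsoOfFin hc
  let g (a : Fin k) : Fin k := e.symm ⟨u a, mem_image_of_mem u (mem_univ a)⟩
  have hg : Function.Injective g := fun a b h => hu (by simpa [g] using h)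
  exact ⟨Equiv.ofBijective g (Finite.injective_iff_bijective.1 hg), fun a b => by simp [g]⟩

theorem mem_prefixOneTwo {d : ℕ} {τ : Equiv.Perm (Fin (d + 2))} :
    τ ∈ prefixOneTwo (d + 2) ↔ τ 0 = 0 ∧ τ 1 = 1 := by
  simp only [prefixOneTwo, Set.mem_ofPred_eq]
  constructor
  · exact fun h => ⟨h 0 (by simp), h 1 (by simp)⟩
  · rintro ⟨h0, h1⟩ i hi
    obtain rfl | rfl : i = 0 ∨ i = 1 := by
      rw [Fin.ext_iff, Fin.ext_iff, Fin.val_zero, Fin.val_one]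
      omega
    · exact h0
    · exact h1

theorem fin_cases_zero_one {d : ℕ} (a : Fin (d + 2)) :
    a = 0 ∨ a = 1 ∨ ∃ b : Fin d, a = b.succ.succ := by
  induction a using Fin.cases with
  | zero => exact Or.inl rfl
  | succ a =>
    induction a using Fin.cases with
    | zero => exact Or.inr (Or.inl rfl)
    | succ a => exact Or.inr (Or.inr ⟨a, rfl⟩)

theorem one_lt_of_ne {d : ℕ} {c : Fin (d + 2)} (h0 : c ≠ 0) (h1 : c ≠ 1) : 1 < c := by
  rw [Ne, Fin.ext_iff] at h0 h1
  rw [Fin.lt_def]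
  rw [Fin.val_zero] at h0
  rw [Fin.val_one] at *
  omega

theorem mem_prefixOneTwo_of_lt {d : ℕ} {τ : Equiv.Perm (Fin (d + 2))} (h01 : τ 0 < τ 1)
    (h : ∀ b : Fin d, τ 1 < τ b.succ.succ) : τ ∈ prefixOneTwo (d + 2) := by
  have h0 : τ 0 = 0 := by
    obtain ⟨a, ha⟩ := τ.surjective 0
    rcases fin_cases_zero_one a with rfl | rfl | ⟨b, rfl⟩
    · exact ha
    · simp [ha] at h01
    · have := h b
      simp [ha] at this
  refine mem_prefixOneTwo.2 ⟨h0, ?_⟩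
  obtain ⟨a, ha⟩ := τ.surjective 1
  rcases fin_cases_zero_one a with rfl | rfl | ⟨b, rfl⟩
  · simp [h0] at ha
  · exact ha
  · have hb := h b
    rw [ha] at hb
    rw [h0] at h01
    rw [Fin.lt_def] at hb h01
    rw [Fin.val_one] at hb
    rw [Fin.val_zero] at h01
    omega

/-- Avoiding all patterns with prefix `12` is a condition on the left-to-right minima. -/
theorem avoids_prefixOneTwo_iff {d n : ℕ} {π : Equiv.Perm (Fin n)} :
    Avoids π (prefixOneTwo (d + 2)) ↔ IsGood d π := by
  constructor
  · intro h i j hij hπ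
    by_contra! hd
    obtain ⟨S, hS, hcard⟩ := exists_subset_card_eq hd
    let g := S.orderEmbOfFin hcard
    have hg (a : Fin d) : j < g a ∧ π j < π (g a) :=
      mem_northEast.1 (hS (S.orderEmbOfFin_mem hcard a))
    let f : Fin (d + 2) → Fin n := Fin.cons i (Fin.cons j g)
    have f0 : f 0 = i := rfl
    have f1 : f 1 = j := rfl
    have f2 (b : Fin d) : f b.succ.succ = g b := rfl
    have hf : StrictMono f := by
      intro a b hab
      rcases fin_cases_zero_one a with rfl | rfl | ⟨a, rfl⟩ <;>
      rcases fin_cases_zero_one b with rfl | rfl | ⟨b, rfl⟩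
      · simp at hab
      · exact hij
      · exact hij.trans (hg b).1
      · simp at hab
      · simp at hab
      · exact (hg b).1
      · simp at hab
      · exact absurd hab (not_lt.2 (by
          rw [Fin.le_def, Fin.val_one, Fin.val_succ]
          omega))
      · exact g.strictMono (by simpa using hab)
    obtain ⟨τ, hτ⟩ := exists_perm_lt_iff (π.injective.comp hf.injective)
    refine h τ (mem_prefixOneTwo_of_lt ((hτ 0 1).1 hπ) fun b => (hτ 1 _).1 ?_) ⟨f, hf, hτ⟩
    exact (hg b).2
  · rintro h τ hτ ⟨f, hf, hfτ⟩
    obtain ⟨h0, h1⟩ := mem_prefixOneTwo.1 hτ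
    have hlt := h (f 0) (f 1) (hf (by simp)) ((hfτ 0 1).2 (by simp [h0, h1]))
    have hsub : univ.image (fun b : Fin d => f b.succ.succ) ⊆ northEast π (f 1) := by
      intro j hj
      obtain ⟨b, -, rfl⟩ := mem_image.1 hj
      have hb0 : b.succ.succ ≠ 0 := Fin.succ_ne_zero _
      have hb1 : b.succ.succ ≠ (1 : Fin (d + 2)) := by
        rw [← Fin.succ_zero_eq_one, Ne, Fin.succ_inj]
        exact Fin.succ_ne_zero _
      refine mem_northEast.2 ⟨hf (one_lt_of_ne hb0 hb1), (hfτ _ _).2 ?_⟩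
      rw [h1]
      exact one_lt_of_ne (fun h => hb0 (τ.injective (h.trans h0.symm)))
        fun h => hb1 (τ.injective (h.trans h1.symm))
    have := card_le_card hsub
    rw [card_image_of_injective _ fun a b hab => by simpa using hf.injective hab, card_fin] at this
    omega

theorem mem_avoidingInvolutions {d n : ℕ} {π : Equiv.Perm (Fin n)} :
    π ∈ avoidingInvolutions n (prefixOneTwo (d + 2)) ↔ π ∈ involutions n ∧ IsGood d π := by
  simp [avoidingInvolutions, avoids_prefixOneTwo_iff]

theorem isGood_of_le {d n : ℕ} (h : n ≤ d) (π : Equiv.Perm (Fin n)) : IsGood d π := by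
  intro i j _ _
  have := card_northEast_add_le π j
  omega

/-! ### Involution polynomials -/

theorem numFixed_le {n : ℕ} (π : Equiv.Perm (Fin n)) : numFixed π ≤ n := by
  exact (card_filter_le _ _).trans (by simp)

theorem involutionPoly_natCast (n : ℕ) :
    involutionPoly (n : ℤ) = ∑ π ∈ involutions n, (Polynomial.X : Polynomial ℚ) ^ numFixed π := by
  rw [involutionPoly, if_pos (by simp), Int.toNat_natCast,
    ← sum_fiberwise_of_maps_to (t := range (n + 1)) (g := numFixed)
      (fun π _ => mem_range.2 (Nat.lt_succ_of_le (numFixed_le π)))]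
  refine sum_congr rfl fun j _ => ?_
  rw [numInvolutions, sum_congr rfl (g := fun _ => Polynomial.X ^ j)]
  · simp
  · intro π hπ
    rw [(mem_filter.1 hπ).2]

theorem involutionPoly_of_neg {m : ℤ} (h : m < 0) : involutionPoly m = 0 := by
  rw [involutionPoly, if_neg (by omega)]

/-! ### Subtree series, kernel equation and telescoping -/

section Potential

/-- The equations satisfied by the generating functions of the descendants of an involution. -/
structure IsKernelSolution (d : ℕ) (β γ T : PowerSeries (Polynomial ℚ)) : Prop where
  kernel : T = 1 + PowerSeries.X ^ 2 * T - (d : PowerSeries (Polynomial ℚ)) * PowerSeries.X ^ 2 * T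
    + (d : PowerSeries (Polynomial ℚ)) * PowerSeries.X ^ 2 * T ^ 2
  pairs : β = 1 + PowerSeries.X ^ 2 * (β + (d : PowerSeries (Polynomial ℚ)) * β * T)
  shallow : γ = β * (1 + PowerSeries.X * PowerSeries.C Polynomial.X
    - (d : PowerSeries (Polynomial ℚ)) * PowerSeries.X ^ 2 * T)
    + (d : PowerSeries (Polynomial ℚ)) * PowerSeries.X ^ 2 * T ^ 2 * γ

variable {d : ℕ} {β γ T : PowerSeries (Polynomial ℚ)}

/-- The generating function of the involutions obtained from `π` by adding points in front. -/
noncomputable def potential (d : ℕ) (β γ T : PowerSeries (Polynomial ℚ)) {n : ℕ}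
    (π : Equiv.Perm (Fin n)) : PowerSeries (Polynomial ℚ) :=
  (if depth d π = 0 then γ else β) * T ^ (n - depth d π - d)

/-- The recursion for f(e) = β T^e: `pairs` is the case e = 0, and the difference of consecutive
cases is β T^e times `kernel`. -/
theorem mul_pow_eq_geom_sum (hK : IsKernelSolution d β γ T) (e : ℕ) :
    β * T ^ e = 1 + PowerSeries.X ^ 2 *
      (∑ i ∈ range (e + 1), β * T ^ i + (d : PowerSeries (Polynomial ℚ)) * (β * T ^ (e + 1))) := by
  induction e with
  | zero =>
    simp only [zero_add, range_one, sum_singleton]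
    linear_combination hK.pairs
  | succ e ih =>
    rw [sum_range_succ]
    linear_combination ih + β * T ^ e * hK.kernel

theorem potential_addPair {n : ℕ} {π : Equiv.Perm (Fin n)} {w : Fin (n + 1)}
    (h : depth d π ≤ w) : potential d β γ T (addPair w π) =
      if d ≤ n - w then β * T ^ (n - w - d) else
        if depth d π = 0 then γ * T ^ (n + 2 - d) else β * T ^ (n + 1 - depth d π - d) := by
  split_ifs with h1 h2
  · rw [potential, depth_addPair_of_le h h1, if_neg (by omega), Nat.add_sub_add_right]
  · rw [potential, depth_addPair_of_lt h (by omega), if_pos h2, if_pos rfl, Nat.sub_zero]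
  · rw [potential, depth_addPair_of_lt h (by omega), if_neg h2, if_neg (by omega)]
    congr 2
    omega

/-- The positions w with depth ≤ w ≤ n - d create a new last deep point and give parameters n - w -
d. The d positions w > n - d create no deep point and raise the parameter by one, or by two at depth
0. -/
theorem sum_potential_addPair {n : ℕ} (hn : d ≤ n) (π : Equiv.Perm (Fin n)) :
    ∑ w : Fin (n + 1), (if depth d π ≤ w then potential d β γ T (addPair w π) else 0) =
      ∑ i ∈ range (n - depth d π - d + 1), β * T ^ i +
        (d : PowerSeries (Polynomial ℚ)) *
          if depth d π = 0 then γ * T ^ (n + 2 - d) else β * T ^ (n + 1 - depth d π - d) := by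
  generalize hc : (if depth d π = 0 then γ * T ^ (n + 2 - d) else
    β * T ^ (n + 1 - depth d π - d)) = c
  have h1 : ∑ w : Fin (n + 1), (if depth d π ≤ w then potential d β γ T (addPair w π) else 0) =
      ∑ w : Fin (n + 1), (fun w : ℕ => if depth d π ≤ w then
        (if d ≤ n - w then β * T ^ (n - w - d) else c) else 0) w := by
    refine sum_congr rfl fun w _ => ?_
    dsimp only
    split_ifs with h h'
    · rw [potential_addPair h, if_pos h']
    · rw [potential_addPair h, if_neg h', hc]
    · rfl
  rw [h1, Fin.sum_univ_eq_sum_range (fun w : ℕ => if depth d π ≤ w then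
    (if d ≤ n - w then β * T ^ (n - w - d) else c) else 0), ← sum_range_reflect]
  obtain ⟨e, he⟩ : ∃ e, n = depth d π + d + e :=
    Nat.exists_eq_add_of_le (depth_add_le hn π)
  have h2 : n - depth d π - d = e := by omega
  -- After reversal, w runs down from n: d positions with no new deep point, e + 1 with one, and
  -- finally the forbidden w below the depth.
  rw [h2, show n + 1 = d + (e + 1) + depth d π by omega, sum_range_add, sum_range_add]
  have h3 : ∀ r ∈ range d, (if depth d π ≤ d + (e + 1) + depth d π - 1 - r then
      (if d ≤ n - (d + (e + 1) + depth d π - 1 - r) then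
        β * T ^ (n - (d + (e + 1) + depth d π - 1 - r) - d) else c) else 0) = c := by
    intro r hr
    rw [mem_range] at hr
    rw [if_pos (by omega), if_neg (by omega)]
  have h4 : ∀ r ∈ range (e + 1), (if depth d π ≤ d + (e + 1) + depth d π - 1 - (d + r) then
      (if d ≤ n - (d + (e + 1) + depth d π - 1 - (d + r)) then
        β * T ^ (n - (d + (e + 1) + depth d π - 1 - (d + r)) - d) else c) else 0) = β * T ^ r := by
    intro r hr
    rw [mem_range] at hr
    rw [if_pos (by omega), if_pos (by omega)]
    congr 2
    omega
  have h5 : ∀ r ∈ range (depth d π),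
      (if depth d π ≤ d + (e + 1) + depth d π - 1 - (d + (e + 1) + r) then
      (if d ≤ n - (d + (e + 1) + depth d π - 1 - (d + (e + 1) + r)) then
        β * T ^ (n - (d + (e + 1) + depth d π - 1 - (d + (e + 1) + r)) - d) else c) else 0) = 0 := by
    intro r hr
    rw [mem_range] at hr
    rw [if_neg (by omega)]
  rw [sum_congr rfl h3, sum_congr rfl h4, sum_congr rfl h5]
  simp [add_comm]

/-- The subtree of π consists of π itself and the subtrees of its admissible children. -/
theorem potential_eq {n : ℕ} (hn : d ≤ n) (π : Equiv.Perm (Fin n))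
    (hK : IsKernelSolution d β γ T) :
    potential d β γ T π = 1 +
      PowerSeries.X * PowerSeries.C Polynomial.X *
        (if depth d π = 0 then potential d β γ T (addFix π) else 0) +
      PowerSeries.X ^ 2 * ∑ w : Fin (n + 1),
        (if depth d π ≤ w then potential d β γ T (addPair w π) else 0) := by
  rw [sum_potential_addPair hn]
  have h := mul_pow_eq_geom_sum hK (n - depth d π - d)
  have hle := depth_add_le hn π
  split_ifs with h0
  · rw [potential, potential, if_pos h0, depth_addFix hn h0, if_neg one_ne_zero]
    rw [h0] at h ⊢
    rw [show n + 1 - 1 - d = n - 0 - d by omega, show n + 2 - d = n - 0 - d + 2 by omega]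
    linear_combination h + T ^ (n - 0 - d) * hK.shallow
  · rw [potential, if_neg h0, show n + 1 - depth d π - d = n - depth d π - d + 1 by omega]
    linear_combination h

open Classical in
/-- The contribution of `π` to the telescoping sum. -/
noncomputable def weight (d : ℕ) (β γ T : PowerSeries (Polynomial ℚ)) {n : ℕ}
    (π : Equiv.Perm (Fin n)) : PowerSeries (Polynomial ℚ) :=
  if IsGood d π then PowerSeries.C (Polynomial.X ^ numFixed π) * potential d β γ T π else 0

theorem coeff_genFun (d n : ℕ) [DecidablePred (IsGood d (n := n))] :
    PowerSeries.coeff n (genFun (d + 2)) =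
      ∑ π ∈ involutions n, if IsGood d π then (Polynomial.X : Polynomial ℚ) ^ numFixed π else 0 := by
  rw [genFun, PowerSeries.coeff_mk, ← sum_filter]
  refine sum_congr ?_ fun _ _ => rfl
  ext π
  rw [mem_avoidingInvolutions, mem_filter]

theorem sum_weight_eq {n : ℕ} (hn : d ≤ n)
    (hK : IsKernelSolution d β γ T) :
    ∑ π ∈ involutions n, weight d β γ T π =
      PowerSeries.C (PowerSeries.coeff n (genFun (d + 2))) +
      PowerSeries.X * ∑ π ∈ involutions n, weight d β γ T (addFix π) +
      PowerSeries.X ^ 2 * ∑ π ∈ involutions n, ∑ w, weight d β γ T (addPair w π) := by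
  classical
  rw [coeff_genFun, map_sum, mul_sum, mul_sum, ← sum_add_distrib, ← sum_add_distrib]
  refine sum_congr rfl fun π hπ => ?_
  rw [mem_involutions] at hπ
  simp only [weight, isGood_addFix, isGood_addPair hπ, numFixed_addFix, numFixed_addPair]
  by_cases hg : IsGood d π
  · simp only [hg, if_true, true_and, ← mul_ite_zero, ← mul_sum]
    rw [potential_eq hn π hK, pow_succ Polynomial.X, map_mul]
    split_ifs <;> ring
  -- A bad involution has nonzero depth, so none of its children is good and all terms vanish.
  · have h0 : depth d π ≠ 0 := fun h => hg fun i j _ _ => depth_eq_zero_iff.1 h j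
    simp [hg, h0]

theorem sum_weight_of_eq :
    ∑ π ∈ involutions d, weight d β γ T π = PowerSeries.C (involutionPoly (d : ℤ)) * γ := by
  rw [involutionPoly_natCast, map_sum, sum_mul]
  refine sum_congr rfl fun π _ => ?_
  have h := depth_add_le le_rfl π
  have h0 : depth d π = 0 := by omega
  rw [weight, if_pos (isGood_of_le le_rfl π), potential, if_pos h0]
  simp

/-- Second entry to the tree: the involutions of length d + 1 that do not start with a fixed point
come from length d - 1, each in d ways, and all have depth 0 and parameter 1. -/
theorem sum_weight_succ :
    ∑ π ∈ involutions (d + 1), weight d β γ T π - ∑ π ∈ involutions d, weight d β γ T (addFix π) =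
      PowerSeries.C (involutionPoly ((d : ℤ) - 1)) * ((d : PowerSeries (Polynomial ℚ)) * γ * T) := by
  cases d with
  | zero =>
    rw [sum_involutions_one, sub_self, involutionPoly_of_neg (by simp)]
    simp
  | succ e =>
    rw [sum_involutions_add_two, add_sub_cancel_left, Nat.cast_succ, add_sub_cancel_right,
      involutionPoly_natCast, map_sum, sum_mul]
    refine sum_congr rfl fun π hπ => ?_
    have h0 : depth (e + 1) π = 0 := depth_eq_zero_iff.2 fun i => by
      have := card_northEast_add_le π i
      omega
    rw [sum_congr rfl (g := fun _ => PowerSeries.C (Polynomial.X ^ numFixed π) * (γ * T))]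
    · simp only [sum_const, card_fin, nsmul_eq_mul]
      push_cast
      ring
    · intro w _
      rw [weight, if_pos, numFixed_addPair, potential_addPair (h0.trans_le (Nat.zero_le _)),
        if_neg (by omega), if_pos h0, show e + 2 - (e + 1) = 1 by omega, pow_one]
      rw [isGood_addPair (mem_involutions.1 hπ), h0]
      exact ⟨isGood_of_le (by omega) π, Nat.zero_le _⟩

theorem sum_X_pow_coeff_genFun (hK : IsKernelSolution d β γ T) (m : ℕ) :
    ∃ r, PowerSeries.C (involutionPoly (d : ℤ)) * γ +
        PowerSeries.X * (PowerSeries.C (involutionPoly ((d : ℤ) - 1)) *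
          ((d : PowerSeries (Polynomial ℚ)) * γ * T)) =
      ∑ i ∈ range m, PowerSeries.X ^ i * PowerSeries.C (PowerSeries.coeff (d + i) (genFun (d + 2)))
        + PowerSeries.X ^ m * r := by
  -- The remainder is the frontier after m levels: the subtrees at length d + m, and those at length
  -- d + m + 1 whose parent is shorter than d + m.
  suffices h : PowerSeries.C (involutionPoly (d : ℤ)) * γ +
        PowerSeries.X * (PowerSeries.C (involutionPoly ((d : ℤ) - 1)) *
          ((d : PowerSeries (Polynomial ℚ)) * γ * T)) =
      ∑ i ∈ range m, PowerSeries.X ^ i * PowerSeries.C (PowerSeries.coeff (d + i) (genFun (d + 2)))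
        + PowerSeries.X ^ m * (∑ π ∈ involutions (d + m), weight d β γ T π +
          PowerSeries.X * (∑ π ∈ involutions (d + m + 1), weight d β γ T π -
            ∑ π ∈ involutions (d + m), weight d β γ T (addFix π))) from ⟨_, h⟩
  induction m with
  | zero => simp [sum_weight_of_eq, sum_weight_succ]
  | succ m ih =>
    rw [ih, sum_range_succ, sum_weight_eq (Nat.le_add_right d m) hK, ← add_assoc d m 1,
      sum_involutions_add_two (n := d + m)]
    ring

theorem genFun_eq (hK : IsKernelSolution d β γ T) :
    genFun (d + 2) =
      ∑ j ∈ range d, PowerSeries.C (involutionPoly (j : ℤ)) * PowerSeries.X ^ j +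
      PowerSeries.X ^ d * (PowerSeries.C (involutionPoly (d : ℤ)) * γ +
        PowerSeries.X * (PowerSeries.C (involutionPoly ((d : ℤ) - 1)) *
          ((d : PowerSeries (Polynomial ℚ)) * γ * T))) := by
  classical
  ext1 n
  have hsum : PowerSeries.coeff n
      (∑ j ∈ range d, PowerSeries.C (involutionPoly (j : ℤ)) * PowerSeries.X ^ j) =
      if n < d then involutionPoly (n : ℤ) else 0 := by
    simp [map_sum, PowerSeries.coeff_C_mul, PowerSeries.coeff_X_pow]
  rw [map_add, hsum]
  rcases lt_or_ge n d with h | h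
  · rw [if_pos h, coeff_genFun, involutionPoly_natCast, PowerSeries.coeff_X_pow_mul',
      if_neg (by omega), add_zero]
    exact sum_congr rfl fun π _ => if_pos (isGood_of_le h.le π)
  · obtain ⟨i, rfl⟩ := Nat.exists_eq_add_of_le h
    rw [if_neg (by omega), zero_add, add_comm d i, PowerSeries.coeff_X_pow_mul]
    obtain ⟨r, hr⟩ := sum_X_pow_coeff_genFun hK (i + 1)
    rw [hr, map_add, PowerSeries.coeff_X_pow_mul', if_neg (by omega), add_zero, map_sum]
    simp [add_comm]

end Potential

/-! ### Solving the kernel equation -/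

theorem binomPow_neg_half_mul_half {A : Type*} [CommRing A] [Algebra ℚ A] {f : PowerSeries A}
    (hf : PowerSeries.constantCoeff f = 1) : binomPow f (-1 / 2) * binomPow f (1 / 2) = 1 := by
  rw [← binomPow_add hf]
  have h := binomPow_natCast hf 0
  norm_num at h ⊢
  exact h

theorem exists_mul_eq_one {A : Type*} [CommRing A] {f : PowerSeries A}
    (hf : PowerSeries.constantCoeff f = 1) : ∃ g, f * g = 1 :=
  (PowerSeries.isUnit_iff_constantCoeff.2 (by simp [hf])).exists_right_inv

/-- The series under the square root in `uZero`. -/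
noncomputable def discrim (k : ℕ) : PowerSeries (Polynomial ℚ) :=
  1 - 2 * ((k : PowerSeries (Polynomial ℚ)) - 1) * PowerSeries.X ^ 2
    + ((k : PowerSeries (Polynomial ℚ)) - 3) ^ 2 * PowerSeries.X ^ 4

theorem constantCoeff_discrim (k : ℕ) : PowerSeries.constantCoeff (discrim k) = 1 := by
  simp [discrim]

theorem uZero_eq (k : ℕ) : uZero k = binomPow (discrim k) (-1 / 2) := rfl

/-- The solution of the kernel equation, with its consequences for the final formula. -/
theorem exists_isKernelSolution (d : ℕ) :
    ∃ β γ T : PowerSeries (Polynomial ℚ), IsKernelSolution d β γ T ∧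
      2 * γ * PowerSeries.X ^ 2 = -PowerSeries.X * (PowerSeries.C Polynomial.X +
        (PowerSeries.C Polynomial.X * ((d : PowerSeries (Polynomial ℚ)) - 1) * PowerSeries.X ^ 2
          - 2 * PowerSeries.X - PowerSeries.C Polynomial.X) * uZero (d + 2)) ∧
      2 * ((d : PowerSeries (Polynomial ℚ)) * γ * T) * PowerSeries.X ^ 4 =
        -PowerSeries.X * (PowerSeries.X + PowerSeries.C Polynomial.X
          - (PowerSeries.X ^ 3 * ((d : PowerSeries (Polynomial ℚ)) - 1)
            - PowerSeries.C Polynomial.X * PowerSeries.X ^ 2 *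
              ((d : PowerSeries (Polynomial ℚ)) + 1)
            + PowerSeries.X + PowerSeries.C Polynomial.X) * uZero (d + 2)) := by
  rw [uZero_eq]
  have hus := binomPow_neg_half_mul_half (constantCoeff_discrim (d + 2))
  have hs2 := binomPow_half_sq (constantCoeff_discrim (d + 2))
  have hs0 := constantCoeff_binomPow (constantCoeff_discrim (d + 2)) (1 / 2)
  generalize binomPow (discrim (d + 2)) (-1 / 2) = u at *
  generalize binomPow (discrim (d + 2)) (1 / 2) = s at *
  rw [discrim] at hs2
  push_cast at hs2
  obtain ⟨h, hh⟩ : ∃ h : Polynomial ℚ, 2 * h = 1 :=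
    ⟨Polynomial.C (1 / 2), by
      rw [← Polynomial.C_ofNat, ← Polynomial.C_mul]
      norm_num⟩
  have hC : 2 * PowerSeries.C h = (1 : PowerSeries (Polynomial ℚ)) := by
    rw [← map_ofNat (PowerSeries.C (R := Polynomial ℚ)) 2, ← map_mul, hh, map_one]
  generalize hP : PowerSeries.C (Polynomial.X : Polynomial ℚ) = P
  obtain ⟨E, hE⟩ : ∃ E : PowerSeries (Polynomial ℚ), E =
    1 + ((d : PowerSeries (Polynomial ℚ)) - 1) * PowerSeries.X ^ 2 := ⟨_, rfl⟩
  have hE0 : PowerSeries.constantCoeff E = 1 := by simp [hE]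
  -- W and V are the roots of z² - E z + d x², with constant terms 1 and 0. Taking T = 1 / W selects
  -- the power series branch and avoids dividing by d, which may be 0.
  obtain ⟨W, hW⟩ : ∃ W, W = PowerSeries.C h * (E + s) := ⟨_, rfl⟩
  obtain ⟨V, hV⟩ : ∃ V, V = PowerSeries.C h * (E - s) := ⟨_, rfl⟩
  obtain ⟨T, hWT⟩ : ∃ T, W * T = 1 := exists_mul_eq_one (by
    rw [hW, map_mul, map_add, hE0, hs0, PowerSeries.constantCoeff_C]
    linear_combination hh)
  obtain ⟨q, hq⟩ : ∃ q, (1 - V) * q = 1 := exists_mul_eq_one (by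
    rw [hV, map_sub, map_mul, map_sub, hE0, hs0]
    simp)
  generalize PowerSeries.C h = c at *
  obtain ⟨x, hx⟩ : ∃ x : PowerSeries (Polynomial ℚ), x = PowerSeries.X := ⟨_, rfl⟩
  obtain ⟨D, hD⟩ : ∃ D : PowerSeries (Polynomial ℚ), D = d := ⟨_, rfl⟩
  rw [← hx, ← hD] at hE hs2
  have hsum : W + V = E := by linear_combination hW + hV + E * hC
  have hdiff : W - V = s := by linear_combination hW - hV + s * hC
  have hc2 : 4 * c ^ 2 = 1 := by linear_combination (2 * c + 1) * hC
  have hWV : W * V = D * x ^ 2 := by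
    rw [hW, hV]
    linear_combination -c ^ 2 * hs2 + c ^ 2 * (E + 1 + (D - 1) * x ^ 2) * hE + D * x ^ 2 * hc2
  have hk : (1 - W) * (1 - V) = x ^ 2 := by linear_combination hWV - hsum - hE
  have hVT : D * x ^ 2 * T = V := by linear_combination -T * hWV + V * hWT
  have hz : T + V * T * u - u = 0 := by
    linear_combination -T * hus - T * u * hdiff + u * hWT
  -- Since (1 - W)(1 - V) = x², the inverse q of 1 - V satisfies q x² = 1 - W, so x² γ needs no
  -- inverse besides u.
  have hg : q * (1 + x * P - V) * u * x ^ 2 = x ^ 2 * u + x * P * (1 - W) * u := by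
    linear_combination (x ^ 2 * u + x * P * u * (1 - W)) * hq - x * P * u * q * hk
  refine ⟨T * q, q * (1 + x * P - V) * u, T, ⟨?_, ?_, ?_⟩, ?_, ?_⟩ <;> rw [← hx, ← hD]
  · linear_combination -T * hsum - T * hE + (1 - T * V) * hWT + T ^ 2 * hWV
  · linear_combination T ^ 2 * q * hWV - V * T * q * hWT + T * q * hk + q * (1 - V) * hWT + hq
  · rw [hP]
    linear_combination (T * q - T * (q * (1 + x * P - V) * u)) * hVT - q * (1 + x * P - V) * hz
  · linear_combination 2 * hg - x * P * u * (hsum + hdiff) - x * P * hus - x * P * u * hE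
  · linear_combination 2 * (q * (1 + x * P - V) * u) * x ^ 2 * hVT + 2 * V * hg
      + (x ^ 2 * u + x * P * u) * (hsum - hdiff + hE) - (x ^ 2 + x * P) * hus - 2 * x * P * u * hWV

/-! ### The formula in Laurent series -/

theorem xPow_add (a b : ℤ) : xPow (a + b) = xPow a * xPow b := by
  simp [xPow, HahnSeries.single_mul_single]

theorem x_pow (n : ℕ) : x ^ n = xPow n := by
  simp [x, xPow, HahnSeries.single_pow]

theorem toLaurent_X : toLaurent PowerSeries.X = x := HahnSeries.ofPowerSeries_X

theorem toLaurent_C (c : Polynomial ℚ) : toLaurent (PowerSeries.C c) = con c :=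
  HahnSeries.ofPowerSeries_C c

theorem smul_eq_con_mul (r : ℚ) (f : LaurentSeries (Polynomial ℚ)) :
    r • f = con (Polynomial.C r) * f := by
  rw [con, HahnSeries.C_mul_eq_smul]
  ext1
  funext a
  rw [HahnSeries.coeff_smul, HahnSeries.coeff_smul, Polynomial.smul_eq_C_mul, smul_eq_mul]

theorem genFun_formula {k : ℕ} (hk : 2 ≤ k) :
    toLaurent (genFun k) =
      ∑ j ∈ range (k - 2), con (involutionPoly (j : ℤ)) * x ^ j
      - (1 / 2 : ℚ) • (xPow ((k : ℤ) - 3) *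
          (p + (p * ((k : LaurentSeries (Polynomial ℚ)) - 3) * x ^ 2 - 2 * x - p) *
            toLaurent (uZero k)) * con (involutionPoly ((k : ℤ) - 2)))
      - (1 / 2 : ℚ) • (xPow ((k : ℤ) - 4) *
          (x + p - (x ^ 3 * ((k : LaurentSeries (Polynomial ℚ)) - 3)
            - p * x ^ 2 * ((k : LaurentSeries (Polynomial ℚ)) - 1) + x + p) *
              toLaurent (uZero k)) * con (involutionPoly ((k : ℤ) - 3))) := by
  obtain ⟨d, rfl⟩ := Nat.exists_eq_add_of_le' hk
  obtain ⟨β, γ, T, hK, h1, h2⟩ := exists_isKernelSolution d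
  replace h1 := congrArg toLaurent h1
  replace h2 := congrArg toLaurent h2
  have hG := congrArg toLaurent (genFun_eq hK)
  simp only [map_mul, map_add, map_sub, map_neg, map_pow, map_sum, map_natCast, map_ofNat, map_one,
    toLaurent_X, toLaurent_C] at h1 h2 hG
  rw [hG, Nat.add_sub_cancel, show ((d + 2 : ℕ) : ℤ) - 2 = d by push_cast; ring,
    show ((d + 2 : ℕ) : ℤ) - 3 = d - 1 by push_cast; ring,
    show ((d + 2 : ℕ) : ℤ) - 4 = d + (-1 + -1) by push_cast; ring, sub_eq_add_neg (d : ℤ) 1]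
  rw [xPow_add, xPow_add, xPow_add, ← x_pow, ← sub_eq_add_neg (d : ℤ) 1]
  have hxy : x * xPow (-1) = 1 := by
    rw [← xPow_add]
    rfl
  have hhalf : 2 * con (Polynomial.C (1 / 2)) = 1 := by
    rw [← map_ofNat (HahnSeries.C (Γ := ℤ)), con, ← map_mul, ← Polynomial.C_ofNat,
      ← Polynomial.C_mul]
    norm_num
  rw [smul_eq_con_mul, smul_eq_con_mul]
  push_cast
  generalize con (Polynomial.C (1 / 2)) = h at *
  simp only [toLaurent, p] at h1 h2 ⊢
  generalize xPow (-1) = y at *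
  generalize HahnSeries.ofPowerSeries ℤ (Polynomial ℚ) γ = g at *
  generalize HahnSeries.ofPowerSeries ℤ (Polynomial ℚ) T = t at *
  generalize HahnSeries.ofPowerSeries ℤ (Polynomial ℚ) (uZero (d + 2)) = u at *
  generalize con Polynomial.X = P at *
  generalize (d : LaurentSeries (Polynomial ℚ)) = D at *
  generalize con (involutionPoly _) = a at *
  generalize con (involutionPoly _) = b at *
  generalize ∑ j ∈ range d, con (involutionPoly (j : ℤ)) * x ^ j = S at *
  generalize hz : x ^ d = z at *
  generalize x = X at *
  -- Here y is the inverse of x and h is one half; they undo the factors 2, x² and x⁴ that kept `h1`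
  -- and `h2` among power series.
  have hx1 : ∀ n : ℕ, X ^ n * y ^ n = 1 := fun n => by rw [← mul_pow, hxy, one_pow]
  have g1 : g = -h * y * (P + (P * (D - 1) * X ^ 2 - 2 * X - P) * u) := by
    linear_combination h * y ^ 2 * h1 - g * hhalf * X ^ 2 * y ^ 2 - g * hx1 2
      - h * y * (P + (P * (D - 1) * X ^ 2 - 2 * X - P) * u) * hxy
  have g2 : X * (D * g * t) = -h * y ^ 2 *
      (X + P - (X ^ 3 * (D - 1) - P * X ^ 2 * (D + 1) + X + P) * u) := by
    linear_combination h * y ^ 3 * h2 - X * (D * g * t) * hhalf * X ^ 3 * y ^ 3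
      - X * (D * g * t) * hx1 3
      - h * y ^ 2 * (X + P - (X ^ 3 * (D - 1) - P * X ^ 2 * (D + 1) + X + P) * u) * hxy
  linear_combination z * a * g1 + z * b * g2

/-! ### Specialisation to p = 1 -/

/-- Set `p = 1`, so as to count involutions without regard to their fixed points. -/
noncomputable def evalOne : PowerSeries (Polynomial ℚ) →+* PowerSeries ℚ :=
  PowerSeries.map (Polynomial.evalRingHom 1)

theorem evalOne_X : evalOne PowerSeries.X = PowerSeries.X := PowerSeries.map_X _

theorem evalOne_C (c : Polynomial ℚ) : evalOne (PowerSeries.C c) = PowerSeries.C (c.eval 1) :=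
  PowerSeries.map_C _ _

theorem evalOne_ofNat (n : ℕ) [n.AtLeastTwo] :
    evalOne (OfNat.ofNat n) = OfNat.ofNat n := map_ofNat _ _

theorem C_ofNat (n : ℕ) [n.AtLeastTwo] :
    PowerSeries.C (OfNat.ofNat n : ℚ) = OfNat.ofNat n := map_ofNat _ _

theorem evalOne_genFun (k : ℕ) : evalOne (genFun k) =
    PowerSeries.mk fun n => ((avoidingInvolutions n (prefixOneTwo k)).card : ℚ) := by
  ext n
  simp [evalOne, genFun]

theorem eval_involutionPoly (n : ℕ) :
    (involutionPoly (n : ℤ)).eval 1 = ∑ _π ∈ involutions n, (1 : ℚ) := by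
  rw [involutionPoly_natCast]
  simp [Polynomial.eval_finsetSum]

theorem eval_involutionPoly_zero : (involutionPoly 0).eval 1 = 1 := by
  have := eval_involutionPoly 0
  rwa [sum_involutions_zero] at this

theorem eval_involutionPoly_one : (involutionPoly 1).eval 1 = 1 := by
  have := eval_involutionPoly 1
  rwa [sum_involutions_one, sum_involutions_zero] at this

theorem eval_involutionPoly_two : (involutionPoly 2).eval 1 = 2 := by
  have := eval_involutionPoly 2
  rw [sum_involutions_add_two, sum_involutions_one, sum_involutions_zero,
    sum_involutions_zero] at this
  norm_num at this
  exact this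

theorem constantCoeff_evalOne_uZero (k : ℕ) :
    PowerSeries.constantCoeff (evalOne (uZero k)) = 1 := by
  rw [evalOne, ← PowerSeries.coeff_zero_eq_constantCoeff_apply, PowerSeries.coeff_map,
    PowerSeries.coeff_zero_eq_constantCoeff_apply, uZero_eq,
    constantCoeff_binomPow (constantCoeff_discrim k), map_one]

theorem evalOne_uZero_sq (k : ℕ) : evalOne (uZero k) ^ 2 * evalOne (discrim k) = 1 := by
  rw [← map_pow, ← map_mul, uZero_eq, binomPow_neg_half_sq (constantCoeff_discrim k), map_one]

theorem evalOne_genFun_three :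
    2 * PowerSeries.X * evalOne (genFun 3) + 1 = (1 + 2 * PowerSeries.X) * evalOne (uZero 3) := by
  obtain ⟨β, γ, T, hK, h1, h2⟩ := exists_isKernelSolution 1
  replace h1 := congrArg evalOne h1
  replace h2 := congrArg evalOne h2
  have hG := congrArg evalOne (genFun_eq hK)
  norm_num [evalOne_X, evalOne_C, eval_involutionPoly_zero, eval_involutionPoly_one] at h1 h2 hG
  rw [evalOne_ofNat 2] at h1 h2
  refine mul_left_cancel₀ (pow_ne_zero 2 (PowerSeries.X_ne_zero (R := ℚ))) ?_
  rw [hG]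
  linear_combination PowerSeries.X ^ 2 * h1 + PowerSeries.X * h2

theorem evalOne_genFun_four :
    2 * evalOne (genFun 4) = 1 - PowerSeries.X +
      (1 + PowerSeries.X) * ((1 + 2 * PowerSeries.X - PowerSeries.X ^ 2) * evalOne (uZero 4)) := by
  obtain ⟨β, γ, T, hK, h1, h2⟩ := exists_isKernelSolution 2
  replace h1 := congrArg evalOne h1
  replace h2 := congrArg evalOne h2
  have hG := congrArg evalOne (genFun_eq hK)
  norm_num [evalOne_X, evalOne_C, eval_involutionPoly_zero, eval_involutionPoly_one,
    eval_involutionPoly_two, sum_range_succ] at h1 h2 hG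
  rw [evalOne_ofNat 2] at h1 h2 hG
  rw [evalOne_ofNat 3] at h2
  rw [C_ofNat 2] at hG
  refine mul_left_cancel₀ (PowerSeries.X_ne_zero (R := ℚ)) ?_
  rw [hG]
  linear_combination 2 * PowerSeries.X * h1 + h2

theorem prefixOneTwo_three : prefixOneTwo 3 = {1} := by
  have h : ∀ τ : Equiv.Perm (Fin 3), τ 0 = 0 ∧ τ 1 = 1 ↔ τ = 1 := by decide
  ext τ
  exact mem_prefixOneTwo.trans (h τ)

theorem prefixOneTwo_four : prefixOneTwo 4 = {1, Equiv.swap 2 3} := by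
  have h : ∀ τ : Equiv.Perm (Fin 4), τ 0 = 0 ∧ τ 1 = 1 ↔ τ = 1 ∨ τ = Equiv.swap 2 3 := by
    decide
  ext τ
  exact mem_prefixOneTwo.trans (h τ)

/-! ### Involutions avoiding 123: coefficients of 1 / √(1 - 4x²) -/

/-- Differentiate the hypothesis and cancel 2v. The resulting linear differential equation gives a
two-step recurrence for the coefficients, that of the central binomial coefficients. -/
theorem derivative_inv_sqrt {v : PowerSeries ℚ} (hv : v ^ 2 * (1 - 4 * PowerSeries.X ^ 2) = 1) :
    PowerSeries.derivative ℚ v * (1 - 4 * PowerSeries.X ^ 2) = 4 * PowerSeries.X * v := by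
  have h0 : 2 * v ≠ 0 := by
    intro h
    have h1 : (2 : PowerSeries ℚ) = 0 := by
      linear_combination -2 * hv + v * (1 - 4 * PowerSeries.X ^ 2) * h
    have h2 := congrArg PowerSeries.constantCoeff h1
    rw [map_ofNat, map_zero] at h2
    exact two_ne_zero h2
  rw [← C_ofNat 4] at hv ⊢
  have h := congrArg (PowerSeries.derivative ℚ) hv
  simp only [Derivation.leibniz, Derivation.leibniz_pow, map_sub, Derivation.map_one_eq_zero,
    smul_eq_mul, nsmul_eq_mul, PowerSeries.derivative_X, PowerSeries.derivative_C] at h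
  refine mul_left_cancel₀ h0 ?_
  push_cast at h
  linear_combination h

theorem coeff_add_two_inv_sqrt {v : PowerSeries ℚ}
    (hv : v ^ 2 * (1 - 4 * PowerSeries.X ^ 2) = 1) (n : ℕ) :
    (n + 2) * PowerSeries.coeff (n + 2) v = 4 * (n + 1) * PowerSeries.coeff n v := by
  have h := congrArg (PowerSeries.coeff (n + 1)) (derivative_inv_sqrt hv)
  rw [show PowerSeries.derivative ℚ v * (1 - 4 * PowerSeries.X ^ 2) = PowerSeries.derivative ℚ v -
      PowerSeries.C 4 * (PowerSeries.X * (PowerSeries.X * PowerSeries.derivative ℚ v)) by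
        rw [map_ofNat]; ring,
    show 4 * PowerSeries.X * v = PowerSeries.C 4 * (PowerSeries.X * v) by rw [map_ofNat]; ring,
    map_sub, PowerSeries.coeff_C_mul, PowerSeries.coeff_C_mul, PowerSeries.coeff_succ_X_mul,
    PowerSeries.coeff_succ_X_mul, PowerSeries.coeff_derivative] at h
  cases n with
  | zero =>
    simp at h ⊢
    linarith
  | succ n =>
    rw [PowerSeries.coeff_succ_X_mul, PowerSeries.coeff_derivative] at h
    push_cast at h ⊢
    linarith

theorem coeff_one_inv_sqrt {v : PowerSeries ℚ}
    (hv : v ^ 2 * (1 - 4 * PowerSeries.X ^ 2) = 1) : PowerSeries.coeff 1 v = 0 := by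
  have h := congrArg PowerSeries.constantCoeff (derivative_inv_sqrt hv)
  rw [map_mul, ← PowerSeries.coeff_zero_eq_constantCoeff_apply, PowerSeries.coeff_derivative] at h
  simpa using h

theorem coeff_even_inv_sqrt {v : PowerSeries ℚ}
    (hv : v ^ 2 * (1 - 4 * PowerSeries.X ^ 2) = 1) (h0 : PowerSeries.constantCoeff v = 1) (m : ℕ) :
    PowerSeries.coeff (2 * m) v = m.centralBinom := by
  induction m with
  | zero => simpa using h0
  | succ m ih =>
    have h := coeff_add_two_inv_sqrt hv (2 * m)
    have hc := congrArg (Nat.cast (R := ℚ)) (Nat.succ_mul_centralBinom_succ m)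
    rw [ih] at h
    push_cast at h hc
    rw [Nat.mul_succ]
    have hm : (m : ℚ) + 1 ≠ 0 := by positivity
    refine mul_left_cancel₀ hm ?_
    linarith

theorem coeff_odd_inv_sqrt {v : PowerSeries ℚ}
    (hv : v ^ 2 * (1 - 4 * PowerSeries.X ^ 2) = 1) (m : ℕ) :
    PowerSeries.coeff (2 * m + 1) v = 0 := by
  induction m with
  | zero => exact coeff_one_inv_sqrt hv
  | succ m ih =>
    have h := coeff_add_two_inv_sqrt hv (2 * m + 1)
    rw [ih, mul_zero] at h
    exact (mul_eq_zero.1 h).resolve_left (by positivity)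

/-- Involutions avoiding `123` are counted by the middle binomial coefficients. -/
theorem card_avoidingInvolutions_three (n : ℕ) :
    (avoidingInvolutions n (prefixOneTwo 3)).card = n.choose (n / 2) := by
  have h0 := constantCoeff_evalOne_uZero 3
  have hv := evalOne_uZero_sq 3
  have hd : evalOne (discrim 3) = 1 - 4 * PowerSeries.X ^ 2 := by
    norm_num [discrim, evalOne_X]
    rw [evalOne_ofNat 4]
  rw [hd] at hv
  have h := congrArg (PowerSeries.coeff (n + 1)) evalOne_genFun_three
  rw [evalOne_genFun, mul_assoc, ← map_ofNat (PowerSeries.C (R := ℚ)), map_add,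
    PowerSeries.coeff_C_mul, PowerSeries.coeff_succ_X_mul, PowerSeries.coeff_mk,
    PowerSeries.coeff_one, if_neg (by omega), add_zero, add_mul, one_mul, map_add, mul_assoc,
    PowerSeries.coeff_C_mul, PowerSeries.coeff_succ_X_mul] at h
  obtain ⟨m, rfl | rfl⟩ := n.even_or_odd'
  · rw [coeff_odd_inv_sqrt hv, coeff_even_inv_sqrt hv h0] at h
    rw [Nat.mul_div_cancel_left m two_pos, ← Nat.centralBinom_eq_two_mul_choose,
      ← Nat.cast_inj (R := ℚ)]
    linarith
  -- For n = 2m + 1 only the coefficient at 2m + 2 survives, and it is twice the binomial of 2m + 1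
  -- over m.
  · rw [coeff_odd_inv_sqrt hv, add_assoc, ← two_mul, ← mul_add, coeff_even_inv_sqrt hv h0,
      Nat.centralBinom_eq_two_mul_choose, Nat.mul_succ, Nat.choose_succ_succ,
      Nat.choose_symm_half] at h
    rw [show (2 * m + 1) / 2 = m by omega, ← Nat.cast_inj (R := ℚ)]
    push_cast at h
    linarith

/-! ### Involutions avoiding 1234 and 1243 -/

theorem eq_of_sq_eq_sq {a b : PowerSeries ℚ} (h : a ^ 2 = b ^ 2)
    (ha : PowerSeries.constantCoeff a = 1) (hb : PowerSeries.constantCoeff b = 1) : a = b := by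
  refine (sq_eq_sq_iff_eq_or_eq_neg.1 h).resolve_right fun h' => ?_
  rw [h', map_neg, hb] at ha
  norm_num at ha

theorem mk_card_avoidingInvolutions_four :
    PowerSeries.mk (fun n => ((avoidingInvolutions n (prefixOneTwo 4)).card : ℚ)) =
      (1 / 2 : ℚ) • (1 - PowerSeries.X) + (1 / 2 : ℚ) • ((1 + PowerSeries.X) *
        binomPow ((1 + 2 * PowerSeries.X - PowerSeries.X ^ 2) *
          (1 - 2 * PowerSeries.X - PowerSeries.X ^ 2)⁻¹) (1 / 2)) := by
  have h0 := constantCoeff_evalOne_uZero 4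
  have hv := evalOne_uZero_sq 4
  have hd : evalOne (discrim 4) = (1 + 2 * PowerSeries.X - PowerSeries.X ^ 2) *
      (1 - 2 * PowerSeries.X - PowerSeries.X ^ 2) := by
    norm_num [discrim, evalOne_X]
    rw [evalOne_ofNat 6]
    ring
  rw [hd] at hv
  have hinv := PowerSeries.mul_inv_cancel
    (1 - 2 * PowerSeries.X - PowerSeries.X ^ 2 : PowerSeries ℚ) (by simp)
  have hf : PowerSeries.constantCoeff ((1 + 2 * PowerSeries.X - PowerSeries.X ^ 2) *
      (1 - 2 * PowerSeries.X - PowerSeries.X ^ 2)⁻¹ : PowerSeries ℚ) = 1 := by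
    simp
  -- The discriminant for k = 4 factors as (1 + 2x - x²)(1 - 2x - x²), so (1 + 2x - x²) u₀ is a
  -- square root of the quotient of the factors; constant term 1 fixes the sign.
  rw [eq_of_sq_eq_sq (b := (1 + 2 * PowerSeries.X - PowerSeries.X ^ 2) * evalOne (uZero 4)) _
    (constantCoeff_binomPow hf _) (by simp [h0]), ← evalOne_genFun, ← smul_add,
    ← evalOne_genFun_four, ← map_ofNat (PowerSeries.C (R := ℚ)), ← PowerSeries.smul_eq_C_mul,
    smul_smul]
  · norm_num
  · rw [binomPow_half_sq hf]
    linear_combination (-(1 + 2 * PowerSeries.X - PowerSeries.X ^ 2) *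
      (1 - 2 * PowerSeries.X - PowerSeries.X ^ 2)⁻¹) * hv +
      (1 + 2 * PowerSeries.X - PowerSeries.X ^ 2) ^ 2 * evalOne (uZero 4) ^ 2 * hinv

end InvAvoid

theorem theorem1 :
    (∀ k : ℕ, 2 ≤ k →
      InvAvoid.toLaurent (InvAvoid.genFun k) =
        ∑ j ∈ Finset.range (k - 2),
          InvAvoid.con (InvAvoid.involutionPoly (j : ℤ)) * InvAvoid.x ^ j
        - (1 / 2 : ℚ) • (InvAvoid.xPow ((k : ℤ) - 3) *
            (InvAvoid.p
              + (InvAvoid.p * ((k : LaurentSeries (Polynomial ℚ)) - 3) * InvAvoid.x ^ 2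
                  - 2 * InvAvoid.x - InvAvoid.p) * InvAvoid.toLaurent (InvAvoid.uZero k)) *
            InvAvoid.con (InvAvoid.involutionPoly ((k : ℤ) - 2)))
        - (1 / 2 : ℚ) • (InvAvoid.xPow ((k : ℤ) - 4) *
            (InvAvoid.x + InvAvoid.p
              - (InvAvoid.x ^ 3 * ((k : LaurentSeries (Polynomial ℚ)) - 3)
                  - InvAvoid.p * InvAvoid.x ^ 2 * ((k : LaurentSeries (Polynomial ℚ)) - 1)
                  + InvAvoid.x + InvAvoid.p) * InvAvoid.toLaurent (InvAvoid.uZero k)) *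
            InvAvoid.con (InvAvoid.involutionPoly ((k : ℤ) - 3)))) ∧
    (∀ n : ℕ,
      (InvAvoid.avoidingInvolutions n {(1 : Equiv.Perm (Fin 3))}).card = n.choose (n / 2)) ∧
    (PowerSeries.mk (fun n : ℕ =>
        ((InvAvoid.avoidingInvolutions n
          {(1 : Equiv.Perm (Fin 4)), Equiv.swap (2 : Fin 4) 3}).card : ℚ)) =
      (1 / 2 : ℚ) • (1 - PowerSeries.X)
      + (1 / 2 : ℚ) • ((1 + PowerSeries.X) *
          InvAvoid.binomPow
            ((1 + 2 * PowerSeries.X - PowerSeries.X ^ 2) *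
              (1 - 2 * PowerSeries.X - PowerSeries.X ^ 2)⁻¹) (1 / 2))) := by
  refine ⟨fun k hk => InvAvoid.genFun_formula hk, fun n => ?_, ?_⟩
  · rw [← InvAvoid.prefixOneTwo_three, InvAvoid.card_avoidingInvolutions_three]
  · rw [← InvAvoid.prefixOneTwo_four]
    exact InvAvoid.mk_card_avoidingInvolutions_four
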